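/- Let $n>1$ be an integer, let $F(a,b)$ be the free group on $a,b$, let $R\in F(a,b)$ be a primitive element (an element contained in some basis of $F(a,b)$), and let $G=\langle a,b;\,R^n\rangle$. Write $C_n$ for the cyclic group of order $n$ and $D_n$ for the dihedral group of order $2n$. Then $G\cong\langle a,b;\,b^n\rangle\cong\mathbb Z*C_n$, and \[ \operatorname{Out}(G)=\operatorname{Aut}(G)/\operatorname{Inn}(G)\;\cong\; D_n\rtimes\operatorname{Aut}(C_n), \] where, writing $D_n=\{r_i, s r_i : i\in\mathbb Z/n\mathbb Z\}$ with rotations $r_i$ and flip $s$, and $C_n=\mathbb Z/n\mathbb Z$, an automorphism $\theta\in\operatorname{Aut}(C_n)$ acts on $D_n$ by fixing the flip ($\theta\cdot s=s$) and acting naturally on the rotations ($\theta\cdot r_i=r_{\theta(i)}$). In particular $|\operatorname{Out}(G)|=2n\varphi(n)$, where $\varphi$ is Euler's totient function. -/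

import Mathlib

/-- An element of a group `F` (in practice, a free group) is primitive if it is contained in some
free basis of `F`. -/
def IsPrimitiveElement.{u} {F : Type u} [Group F] (x : F) : Prop :=
  ∃ (ι : Type u) (B : FreeGroupBasis ι F), x ∈ Set.range B

/-- The group `⟨a, b; R ^ n⟩`, where the free group `F(a, b)` is `FreeGroup (Fin 2)`, with
`a = FreeGroup.of 0` and `b = FreeGroup.of 1`. -/
abbrev TwoGenOneRel (R : FreeGroup (Fin 2)) (n : ℕ) : Type :=
  PresentedGroup ({R ^ n} : Set (FreeGroup (Fin 2)))

/-- The group of inner automorphisms of `G`. -/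
def InnerAut (G : Type*) [Group G] : Subgroup (MulAut G) :=
  (MulAut.conj : G →* MulAut G).range

instance InnerAut.instNormal (G : Type*) [Group G] : (InnerAut G).Normal := by
  refine ⟨?_⟩
  rintro _ ⟨g, rfl⟩ φ
  refine ⟨φ g, ?_⟩
  ext x
  simp [MulAut.conj_apply]

/-- The outer automorphism group `Out(G) = Aut(G) / Inn(G)`. -/
abbrev OuterAut (G : Type*) [Group G] : Type _ :=
  MulAut G ⧸ InnerAut G

/-- The cyclic group `C_n` of order `n`, written multiplicatively. -/
abbrev CyclicGrp (n : ℕ) : Type := Multiplicative (ZMod n)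

/-- The action of an automorphism `θ` of `C_n` on the dihedral group `D_n`: it sends the rotation
`r i` to `r (θ i)` and the reflection `sr i = (sr 0) (r i)` to `sr (θ i)`. -/
def dihedralAut {n : ℕ} (θ : MulAut (CyclicGrp n)) : MulAut (DihedralGroup n) where
  toFun
    | .r i => .r (θ (Multiplicative.ofAdd i)).toAdd
    | .sr i => .sr (θ (Multiplicative.ofAdd i)).toAdd
  invFun
    | .r i => .r (θ⁻¹ (Multiplicative.ofAdd i)).toAdd
    | .sr i => .sr (θ⁻¹ (Multiplicative.ofAdd i)).toAdd
  left_inv := by rintro (i | i) <;> simp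
  right_inv := by rintro (i | i) <;> simp
  map_mul' := by rintro (i | i) (j | j) <;> simp

/-- The natural action of `Aut(C_n)` on the dihedral group `D_n`. -/
def dihedralAction (n : ℕ) : MulAut (CyclicGrp n) →* MulAut (DihedralGroup n) where
  toFun := dihedralAut
  map_one' := by ext (i | i) <;> rfl
  map_mul' := by intro θ η; ext (i | i) <;> rfl

/-! An automorphism of the free group carries `R` to `b`, so `G` is the free product of `C_n` and an
infinite cyclic group `⟨t⟩`. This is modelled as an HNN extension over trivial subgroups, so that
Britton's lemma supplies reduced words in `t ^ ±1` and `C`.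

An element of finite order is conjugate into `C` (`exists_conj_of_isOfFinOrder`). So every
automorphism, up to an inner one, preserves `C_n` and induces some `θ` there. After dividing by `θ`,
it fixes `C_n` pointwise. A length argument (`Reduced.length_eq_one`) then forces `t ↦ a * t ^ ±1 *
b` with `a, b` in `C_n`, and conjugating by `a⁻¹` leaves `t ↦ t ^ ±1 * c`. These `2n` normal forms
are indexed by `D_n` and compose as in `D_n ⋊ Aut(C_n)` up to inner automorphisms
(`endo_comp_endo`). No two pairs `(d, θ)` give the same outer class, because the exponent sum of `t`
and the retraction onto `C_n` have abelian targets and hence ignore conjugation. -/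

/-- The free product of `C` with an infinite cyclic group generated by the letter
`HNNExtension.t`, presented as an HNN extension with trivial associated subgroups. -/
abbrev FreeExt (C : Type*) [Group C] : Type _ :=
  HNNExtension C ⊥ ⊥ (MulEquiv.refl (⊥ : Subgroup C))

/-! ### Reduced words, torsion and automorphisms of the free product of `C` and `ℤ`. -/

namespace FreeExt

open HNNExtension

variable {C : Type*} [Group C] {K : Type*} [Group K]

/-- The homomorphism from `FreeExt C` given by a homomorphism on `C` and the image of the letter. -/
def lift (f : C →* K) (x : K) : FreeExt C →* K :=
  HNNExtension.lift f x (by rintro ⟨a, rfl⟩; simp)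

@[simp]
theorem lift_t (f : C →* K) (x : K) : lift f x t = x := HNNExtension.lift_t ..

@[simp]
theorem lift_of (f : C →* K) (x : K) (c : C) : lift f x (of c) = f c := HNNExtension.lift_of ..

/-- The exponent sum of the letter. -/
def degree : FreeExt C →* Multiplicative ℤ := lift 1 (Multiplicative.ofAdd 1)

/-- The retraction of `FreeExt C` onto `C` that kills the letter. -/
def retraction : FreeExt C →* C := lift (MonoidHom.id C) 1

@[simp]
theorem degree_of (c : C) : degree (of c : FreeExt C) = 1 := by simp [degree]

@[simp]
theorem degree_t : degree (t : FreeExt C) = Multiplicative.ofAdd 1 := by simp [degree]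

@[simp]
theorem retraction_of (c : C) : retraction (of c : FreeExt C) = c := by simp [retraction]

theorem induction_left {P : FreeExt C → Prop} (one : P 1)
    (of_mul : ∀ c g, P g → P (of c * g)) (t_mul : ∀ (e : ℤˣ) g, P g → P (t ^ (e : ℤ) * g))
    (g : FreeExt C) : P g := by
  have key : ∀ g : FreeExt C, ∀ h, P h ↔ P (g * h) := by
    intro g
    induction g using HNNExtension.induction_on with
    | of c =>
      refine fun h => ⟨of_mul c h, fun hh => ?_⟩
      simpa using of_mul c⁻¹ _ hh
    | t =>
      refine fun h => ⟨fun hh => by simpa using t_mul 1 h hh, fun hh => ?_⟩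
      simpa using t_mul (-1) _ hh
    | mul x y hx hy => intro h; rw [hy h, hx, mul_assoc]
    | inv x hx => intro h; rw [hx (x⁻¹ * h)]; simp
  simpa using (key g 1).1 one

/-- `Reduced e d L g` says that `g` is the value of a reduced word of the form
`t ^ e * c₁ * t ^ e₂ * c₂ * ⋯ * t ^ d` with `L` letters `t ^ ±1`. -/
inductive Reduced : ℤˣ → ℤˣ → ℕ → FreeExt C → Prop
  | single (e : ℤˣ) : Reduced e e 1 (t ^ (e : ℤ))
  | cons {e f d : ℤˣ} {c : C} {L : ℕ} {g : FreeExt C} (h : Reduced f d L g) (hc : c = 1 → e = f) :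
      Reduced e d (L + 1) (t ^ (e : ℤ) * of c * g)

namespace Reduced

variable {e d e' d' : ℤˣ} {L L' : ℕ} {g g' : FreeExt C}

theorem pos (h : Reduced e d L g) : 0 < L := by cases h <;> omega

theorem mul (h : Reduced e d L g) (h' : Reduced e' d' L' g') {c : C} (hc : c = 1 → d = e') :
    Reduced e d' (L + L') (g * of c * g') := by
  induction h with
  | single e => rw [add_comm]; exact cons h' hc
  | cons h hc' ih =>
    have := cons (ih hc) hc'
    rwa [show ∀ a b : ℕ, a + b + 1 = a + 1 + b by omega,
      ← mul_assoc, ← mul_assoc] at this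

theorem inv (h : Reduced e d L g) : Reduced (-d) (-e) L g⁻¹ := by
  induction h with
  | single e => simpa using single (C := C) (-e)
  | @cons e f d c L g h hc ih =>
    have := ih.mul (single (-e)) (c := c⁻¹) (by simpa [eq_comm] using hc)
    simpa [mul_assoc] using this

theorem exists_chain (h : Reduced e d L g) : ∃ (c : C) (l : List (ℤˣ × C)),
    ((e, c) :: l).IsChain (fun a b => a.2 ∈ HNNExtension.toSubgroup ⊥ ⊥ a.1 → a.1 = b.1) ∧
    (((e, c) :: l).map (fun x => (t ^ (x.1 : ℤ) * of x.2 : FreeExt C))).prod = g := by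
  induction h with
  | single e => exact ⟨1, [], by simp, by simp⟩
  | @cons e f d c L g h hc ih =>
    obtain ⟨c', l, hl, hg⟩ := ih
    refine ⟨c, (f, c') :: l, ?_, ?_⟩
    · rw [List.isChain_cons_cons]
      refine ⟨fun h1 => hc ?_, hl⟩
      rcases Int.units_eq_one_or e with rfl | rfl <;> simpa using h1
    · rw [List.map_cons, List.prod_cons, hg]

/-- Britton's lemma for trivial associated subgroups. -/
theorem ne_of (h : Reduced e d L g) (c : C) : g ≠ of c := by
  rintro rfl
  obtain ⟨c', l, hl, hg⟩ := h.exists_chain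
  have := HNNExtension.ReducedWord.toList_eq_nil_of_mem_of_range (MulEquiv.refl (⊥ : Subgroup C))
    ⟨1, _, hl⟩ ⟨c, by simp only [HNNExtension.NormalWord.ReducedWord.prod, hg]; simp⟩
  simp at this

theorem of_mul_mul_of_ne_of (h : Reduced e d L g) (a b c : C) : of a * g * of b ≠ of c := by
  intro H
  apply h.ne_of (a⁻¹ * c * b⁻¹)
  simp [← H, mul_assoc]

theorem ne_of_mul_t_mul_of (h : Reduced e d L g) (hL : 1 < L) (a b : C) :
    g ≠ of a * t * of b := by
  cases h with
  | single => omega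
  | @cons _ f _ c L g h hc =>
    intro H
    by_cases H' : a = 1 ∧ e = 1
    · obtain ⟨rfl, rfl⟩ := H'
      refine h.of_mul_mul_of_ne_of c 1 b ?_
      have : t * (of c * g) = t * of b := by simpa [mul_assoc] using H
      simpa using this
    -- Otherwise `t⁻¹ * a⁻¹` can be prepended to `g` without cancellation, yet the product would be
    -- `of b`.
    · have h2 := cons (cons h hc) (c := a⁻¹) (e := -1) (by
        intro h1
        rcases Int.units_eq_one_or e with rfl | rfl
        · exact absurd ⟨by simpa using h1, rfl⟩ H'
        · rfl)
      refine h2.ne_of b ?_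
      rw [H]; simp [mul_assoc]

/-- The outermost letters of a reduced word. -/
theorem shell (h : Reduced e d L g) :
    (L = 1 ∧ e = d ∧ g = t ^ (e : ℤ)) ∨
    (∃ c : C, (c = 1 → e = d) ∧ L = 2 ∧ g = t ^ (e : ℤ) * of c * t ^ (d : ℤ)) ∨
    ∃ (f f' : ℤˣ) (c c' : C) (M : ℕ) (k : FreeExt C), Reduced f f' M k ∧ L = M + 2 ∧
      (c = 1 → e = f) ∧ (c' = 1 → f' = d) ∧
      g = t ^ (e : ℤ) * of c * k * of c' * t ^ (d : ℤ) := by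
  induction h with
  | single e => simp
  | @cons e f d c L g h hc ih =>
    right
    rcases ih with ⟨rfl, rfl, rfl⟩ | ⟨c', hc', rfl, rfl⟩ | ⟨f1, f2, c1, c2, M, k, hk, rfl, h1, h2, rfl⟩
    · exact Or.inl ⟨c, hc, rfl, rfl⟩
    · exact Or.inr ⟨f, f, c, c', 1, _, single f, rfl, hc, hc', by simp [mul_assoc]⟩
    · exact Or.inr ⟨f, f2, c, c2, M + 1, _, cons hk h1, rfl, hc, h2, by simp [mul_assoc]⟩

theorem pow_mul (h : Reduced e d L g) {c : C} (hc : c = 1 → d = e) (m : ℕ) :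
    Reduced e d ((m + 1) * L) ((g * of c) ^ m * g) := by
  induction m with
  | zero => simpa using h
  | succ m ih =>
    have := h.mul ih hc
    rwa [← mul_assoc, ← pow_succ', show L + (m + 1) * L = (m + 1 + 1) * L by ring] at this

theorem mul_pow_succ_mul (a k b : K) (m : ℕ) :
    (a * k * b) ^ (m + 1) = a * ((k * (b * a)) ^ m * k) * b := by
  induction m with
  | zero => simp
  | succ m ih => rw [pow_succ', ih, pow_succ' _ m]; simp only [mul_assoc]

theorem eq_neg_of_ne (h : d ≠ e) : d = -e := by
  rcases Int.units_eq_one_or e with rfl | rfl <;> rcases Int.units_eq_one_or d with rfl | rfl <;>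
    simp_all

/-- Powers of an element of infinite order do not get shorter: outer letters that would cancel
between adjacent factors are peeled off as a conjugation, and they survive at the two ends of the
power. -/
theorem exists_pow (h : Reduced e d L g) (hg : ∀ m : ℕ, g ^ (m + 1) ≠ 1) (m : ℕ) :
    ∃ M, L ≤ M ∧ Reduced e d M (g ^ (m + 1)) := by
  induction L using Nat.strong_induction_on generalizing e d g with
  | _ L ih =>
  by_cases hde : d = e
  · have := h.pow_mul (c := 1) (fun _ => hde) m
    rw [map_one, mul_one, ← pow_succ] at this
    exact ⟨_, Nat.le_mul_of_pos_left L m.succ_pos, this⟩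
  obtain rfl := eq_neg_of_ne hde
  rcases h.shell with ⟨-, he, -⟩ | ⟨c, hc, rfl, rfl⟩ | ⟨f, f', c, c', M, k, hk, rfl, hc, hc', rfl⟩
  · exact absurd he.symm hde
  · have hp : ∀ m, (t ^ (e : ℤ) * of c * t ^ ((-e : ℤˣ) : ℤ) : FreeExt C) ^ m =
        t ^ (e : ℤ) * of (c ^ m) * t ^ ((-e : ℤˣ) : ℤ) := by
      intro m
      simp [conj_pow]
    refine ⟨2, le_rfl, ?_⟩
    have hcm : c ^ (m + 1) ≠ 1 := by
      intro H
      apply hg m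
      rw [hp, H]; simp
    rw [hp]
    exact cons (single (-e)) (fun h => absurd h hcm)
  · have hp : ∀ m, (t ^ (e : ℤ) * of c * k * of c' * t ^ ((-e : ℤˣ) : ℤ) : FreeExt C) ^ (m + 1) =
        t ^ (e : ℤ) * of c * ((k * of (c' * c)) ^ m * k) * of c' * t ^ ((-e : ℤˣ) : ℤ) := by
      intro m
      have := mul_pow_succ_mul (of c) k (of c') m
      rw [Units.val_neg, zpow_neg, mul_assoc (t ^ (e : ℤ)), mul_assoc (t ^ (e : ℤ)), conj_pow, this]
      simp [mul_assoc]
    have main : ∃ N, M ≤ N ∧ Reduced f f' N ((k * of (c' * c)) ^ m * k) := by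
      by_cases h1 : c' * c = 1
      · rw [h1, map_one, mul_one, ← pow_succ]
        refine ih M (by omega) hk fun j hj => hg j ?_
        rw [hp, h1, map_one, mul_one, ← pow_succ, hj]
        simp [mul_assoc, mul_eq_one_iff_eq_inv.1 h1]
      · exact ⟨_, Nat.le_mul_of_pos_left M m.succ_pos, hk.pow_mul (fun h => absurd h h1) m⟩
    obtain ⟨N, hN, hR⟩ := main
    refine ⟨N + 1 + 1, by omega, ?_⟩
    rw [hp, show N + 1 + 1 = (N + 1) + 1 from rfl]
    exact (cons hR hc).mul (single (-e)) hc'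

theorem exists_zpow (h : Reduced e d L g) (hg : ∀ m : ℕ, g ^ (m + 1) ≠ 1) {m : ℤ} (hm : m ≠ 0) :
    ∃ e' d' M, L ≤ M ∧ Reduced e' d' M (g ^ m) := by
  obtain ⟨j, rfl | rfl⟩ := m.eq_nat_or_neg <;> obtain ⟨i, rfl⟩ : ∃ i, j = i + 1 :=
    Nat.exists_eq_succ_of_ne_zero (by rintro rfl; simp at hm)
  · obtain ⟨M, hM, H⟩ := h.exists_pow hg i
    exact ⟨_, _, M, hM, by rwa [zpow_natCast]⟩
  · obtain ⟨M, hM, H⟩ := h.exists_pow hg i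
    exact ⟨_, _, M, hM, by rw [zpow_neg, zpow_natCast]; exact H.inv⟩

end Reduced

theorem exists_reduced (g : FreeExt C) : (∃ c : C, g = of c) ∨
    ∃ (a b : C) (e d : ℤˣ) (L : ℕ) (k : FreeExt C), Reduced e d L k ∧ g = of a * k * of b := by
  induction g using induction_left with
  | one => exact Or.inl ⟨1, by simp⟩
  | of_mul c g ih =>
    rcases ih with ⟨a, rfl⟩ | ⟨a, b, e, d, L, k, hk, rfl⟩
    · exact Or.inl ⟨c * a, by simp⟩
    · exact Or.inr ⟨c * a, b, e, d, L, k, hk, by simp [mul_assoc]⟩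
  | t_mul u g ih =>
    rcases ih with ⟨a, rfl⟩ | ⟨a, b, e, d, L, k, hk, rfl⟩
    · exact Or.inr ⟨1, a, _, _, _, _, .single u, by simp⟩
    · by_cases H : a = 1 → u = e
      · exact Or.inr ⟨1, b, _, _, _, _, .cons hk H, by simp [mul_assoc]⟩
      · obtain ⟨rfl, hu⟩ := Classical.not_imp.1 H
        obtain rfl := Reduced.eq_neg_of_ne hu
        cases hk with
        | single => exact Or.inl ⟨b, by simp⟩
        | @cons _ f _ c L g h hc => exact Or.inr ⟨c, b, _, _, _, _, h, by simp [mul_assoc]⟩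

/-- A cyclically reduced word containing `t` has reduced, hence nontrivial, powers. Any other word
is shortened by conjugation, so torsion ends up in `C`. -/
theorem exists_conj_of_isOfFinOrder {g : FreeExt C} (hg : IsOfFinOrder g) :
    ∃ (u : FreeExt C) (c : C), u * g * u⁻¹ = of c := by
  have key : ∀ (L : ℕ) (e d : ℤˣ) (k : FreeExt C) (c : C), Reduced e d L k →
      IsOfFinOrder (k * of c) → ∃ (u : FreeExt C) (a : C), u * (k * of c) * u⁻¹ = of a := by
    intro L
    induction L using Nat.strong_induction_on with
    | _ L ih =>
    intro e d k c hk hfin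
    by_cases hc : c = 1 → d = e
    · obtain ⟨m, hm, h1⟩ := hfin.exists_pow_eq_one
      obtain ⟨i, rfl⟩ := Nat.exists_eq_succ_of_ne_zero hm.ne'
      refine absurd ?_ ((hk.pow_mul hc i).of_mul_mul_of_ne_of 1 c 1)
      rw [map_one, one_mul, mul_assoc, ← pow_succ, h1]
    · obtain ⟨rfl, hde⟩ := Classical.not_imp.1 hc
      obtain rfl := Reduced.eq_neg_of_ne hde
      rw [map_one, mul_one] at hfin ⊢
      rcases hk.shell with ⟨-, he, -⟩ | ⟨c, -, -, rfl⟩ | ⟨f, f', a, b, M, k, hk', rfl, -, -, rfl⟩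
      · exact absurd he.symm hde
      · exact ⟨t ^ (-(e : ℤ)), c, by simp [mul_assoc]⟩
      · have hconj : (t ^ (e : ℤ) * of a)⁻¹ *
            (t ^ (e : ℤ) * of a * k * of b * t ^ ((-e : ℤˣ) : ℤ)) * (t ^ (e : ℤ) * of a)⁻¹⁻¹ =
            k * of (b * a) := by simp [mul_assoc]
        obtain ⟨u, x, hu⟩ := ih M (by omega) f f' k (b * a) hk' (by
          rw [← hconj, ← MulAut.conj_apply]
          exact (MulAut.conj _ : MulAut (FreeExt C)).toMonoidHom.isOfFinOrder hfin)
        refine ⟨u * (t ^ (e : ℤ) * of a)⁻¹, x, ?_⟩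
        rw [← hu, ← hconj]
        simp only [mul_inv_rev, mul_assoc]
  rcases exists_reduced g with ⟨c, rfl⟩ | ⟨a, b, e, d, L, k, hk, rfl⟩
  · exact ⟨1, c, by simp⟩
  · have hconj : (of a)⁻¹ * (of a * k * of b) * (of a)⁻¹⁻¹ = k * of (b * a) := by
      simp [mul_assoc]
    obtain ⟨u, x, hu⟩ := key L e d k (b * a) hk (by
      rw [← hconj, ← MulAut.conj_apply]
      exact (MulAut.conj _ : MulAut (FreeExt C)).toMonoidHom.isOfFinOrder hg)
    refine ⟨u * (of a)⁻¹, x, ?_⟩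
    rw [← hu, ← hconj]
    simp only [mul_inv_rev, mul_assoc]

/-! ### Endomorphisms that fix `C` pointwise. -/

/-- Alternating products of nonzero powers of `w` and nontrivial elements of `C` that begin and
end with a power of `w`. -/
inductive Alternating (w : FreeExt C) : FreeExt C → Prop
  | pow {m : ℤ} (hm : m ≠ 0) : Alternating w (w ^ m)
  | cons {m : ℤ} {c : C} {g : FreeExt C} (hm : m ≠ 0) (hc : c ≠ 1) (h : Alternating w g) :
      Alternating w (w ^ m * of c * g)

/-- Each nonzero power of `w` has length at least `L`, and the nontrivial separators from `C`
prevent cancellation between them. -/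
theorem Alternating.exists_reduced {e d : ℤˣ} {L : ℕ} {w g : FreeExt C} (hw : Reduced e d L w)
    (hw' : ∀ m : ℕ, w ^ (m + 1) ≠ 1) (h : Alternating w g) :
    ∃ e' d' M, L ≤ M ∧ Reduced e' d' M g := by
  induction h with
  | pow hm => exact hw.exists_zpow hw' hm
  | cons hm hc h ih =>
    obtain ⟨e1, d1, M1, hM1, h1⟩ := hw.exists_zpow hw' hm
    obtain ⟨e2, d2, M2, hM2, h2⟩ := ih
    exact ⟨e1, d2, M1 + M2, by omega, h1.mul h2 fun h => absurd h hc⟩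

theorem exists_alternating (w g : FreeExt C) : (∃ c : C, lift of w g = of c) ∨
    ∃ (a b : C) (k : FreeExt C), Alternating w k ∧ lift of w g = of a * k * of b := by
  induction g using induction_left with
  | one => exact Or.inl ⟨1, by simp⟩
  | of_mul c g ih =>
    rw [map_mul, lift_of]
    rcases ih with ⟨a, h⟩ | ⟨a, b, k, hk, h⟩
    · exact Or.inl ⟨c * a, by simp [h]⟩
    · exact Or.inr ⟨c * a, b, k, hk, by simp [h, mul_assoc]⟩
  | t_mul u g ih =>
    rw [map_mul, map_zpow, lift_t]
    have hu : (u : ℤ) ≠ 0 := u.ne_zero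
    rcases ih with ⟨a, h⟩ | ⟨a, b, k, hk, h⟩
    · exact Or.inr ⟨1, a, _, .pow hu, by simp [h]⟩
    · rw [h]
      by_cases ha : a = 1
      · subst ha
        cases hk with
        | @pow m hm =>
          by_cases hum : (u : ℤ) + m = 0
          · exact Or.inl ⟨b, by simp [← mul_assoc, ← zpow_add, hum]⟩
          · exact Or.inr ⟨1, b, _, .pow hum, by simp [zpow_add, mul_assoc]⟩
        | @cons m c k hm hc hk =>
          by_cases hum : (u : ℤ) + m = 0
          · exact Or.inr ⟨c, b, _, hk, by simp [← mul_assoc, ← zpow_add, hum]⟩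
          · exact Or.inr ⟨1, b, _, .cons hum hc hk, by simp [zpow_add, mul_assoc]⟩
      · exact Or.inr ⟨1, b, _, .cons hu ha hk, by simp [mul_assoc]⟩

/-- The image of `t ↦ w` consists of elements of `C` and of elements of length at least `L`, so it
can contain `t` only if `L = 1`. -/
theorem Reduced.length_eq_one {e d : ℤˣ} {L : ℕ} {w : FreeExt C} (hw : Reduced e d L w)
    (hw' : ∀ m : ℕ, w ^ (m + 1) ≠ 1) (hsurj : Function.Surjective (lift of w)) : L = 1 := by
  by_contra hL
  have hL1 : 1 < L := by have := hw.pos; omega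
  obtain ⟨g, hg⟩ := hsurj t
  rcases exists_alternating w g with ⟨c, h⟩ | ⟨a, b, k, hk, h⟩
  · have := congrArg degree (hg.symm.trans h)
    simp at this
  · obtain ⟨e', d', M, hM, hR⟩ := hk.exists_reduced hw hw'
    refine hR.ne_of_mul_t_mul_of (by omega) a⁻¹ b⁻¹ ?_
    rw [← hg, h]
    simp [mul_assoc]

/-- An automorphism that fixes `C` pointwise sends the letter to `a * t ^ ±1 * b`. -/
theorem exists_eq_of_forall_of (φ : MulAut (FreeExt C)) (hφ : ∀ c : C, φ (of c) = of c) :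
    ∃ (a b : C) (e : ℤˣ), φ t = of a * t ^ (e : ℤ) * of b := by
  rcases exists_reduced (φ t) with ⟨c, h⟩ | ⟨a, b, e, d, L, k, hk, h⟩
  · have := congrArg degree (φ.injective (h.trans (hφ c).symm))
    simp at this
  · have hk' : k = φ (of a⁻¹ * t * of b⁻¹) := by simp [h, hφ, mul_assoc]
    -- The preimage `a⁻¹ * t * b⁻¹` of `k` has exponent sum `1`, so `k` has infinite order. The map
    -- `t ↦ k` is onto because precomposing it with `t ↦ a * t * b` gives `φ`.
    have hL := hk.length_eq_one (fun m hm => by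
      rw [hk', ← map_pow, EmbeddingLike.map_eq_one_iff] at hm
      have := congrArg (fun x => (degree x).toAdd) hm
      simp at this
      omega) (fun y => by
      obtain ⟨x, rfl⟩ := φ.surjective y
      refine ⟨lift of (of a * t * of b) x, ?_⟩
      change ((lift of k).comp (lift of (of a * t * of b))) x = φ.toMonoidHom x
      congr 1
      ext <;> simp [hφ, h])
    subst hL
    cases hk with
    | single => exact ⟨a, b, e, h⟩
    | cons h' => exact absurd h'.pos (by omega)

end FreeExt

/-! ### The isomorphism from `D_n ⋊ Aut(C_n)` to the outer automorphism group. -/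

@[simp]
theorem dihedralAction_r {n : ℕ} (θ : MulAut (CyclicGrp n)) (i : ZMod n) :
    dihedralAction n θ (.r i) = .r (θ (Multiplicative.ofAdd i)).toAdd := rfl

@[simp]
theorem dihedralAction_sr {n : ℕ} (θ : MulAut (CyclicGrp n)) (i : ZMod n) :
    dihedralAction n θ (.sr i) = .sr (θ (Multiplicative.ofAdd i)).toAdd := rfl

theorem CyclicGrp.exists_zpow_eq {n : ℕ} (c : CyclicGrp n) :
    ∃ k : ℤ, Multiplicative.ofAdd (1 : ZMod n) ^ k = c := by
  obtain ⟨k, hk⟩ := ZMod.intCast_surjective c.toAdd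
  exact ⟨k, by rw [← ofAdd_zsmul, zsmul_one, hk, ofAdd_toAdd]⟩

namespace FreeExt

open HNNExtension

variable {n : ℕ}

/-- The image of the letter under the automorphism attached to an element of `D_n`. -/
def letterImage : DihedralGroup n → FreeExt (CyclicGrp n)
  | .r i => t * of (Multiplicative.ofAdd i)
  | .sr i => t⁻¹ * of (Multiplicative.ofAdd i)

@[simp]
theorem letterImage_r (i : ZMod n) :
    letterImage (.r i) = t * of (Multiplicative.ofAdd i) := rfl

@[simp]
theorem letterImage_sr (i : ZMod n) :
    letterImage (.sr i) = t⁻¹ * of (Multiplicative.ofAdd i) := rfl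

/-- The endomorphism of `ℤ * C_n` attached to an element of `D_n ⋊ Aut(C_n)`. -/
def endo (p : DihedralGroup n ⋊[dihedralAction n] MulAut (CyclicGrp n)) :
    FreeExt (CyclicGrp n) →* FreeExt (CyclicGrp n) :=
  lift (of.comp p.right.toMonoidHom) (letterImage p.left)

@[simp]
theorem endo_of (p : DihedralGroup n ⋊[dihedralAction n] MulAut (CyclicGrp n))
    (c : CyclicGrp n) : endo p (of c) = of (p.right c) := by simp [endo]

@[simp]
theorem endo_t (p : DihedralGroup n ⋊[dihedralAction n] MulAut (CyclicGrp n)) :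
    endo p t = letterImage p.left := by simp [endo]

theorem endo_one : endo (1 : DihedralGroup n ⋊[dihedralAction n] MulAut (CyclicGrp n)) =
    MonoidHom.id _ := by
  ext
  · simp
  · simp [DihedralGroup.one_def, -DihedralGroup.r_zero]

theorem endo_comp_endo (p q : DihedralGroup n ⋊[dihedralAction n] MulAut (CyclicGrp n)) :
    ∃ u, (endo p).comp (endo q) = (MulAut.conj u).toMonoidHom.comp (endo (p * q)) := by
  have main : ∃ c : CyclicGrp n, endo p (letterImage q.left) =
      of c * letterImage (p * q).left * (of c)⁻¹ := by
    rw [SemidirectProduct.mul_left]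
    rcases q.left with j | j <;> rcases hp : p.left with i | i
    · exact ⟨1, by simp [hp, mul_assoc]⟩
    · exact ⟨1, by simp [hp, mul_assoc]⟩
    -- A flip `q.left` inverts the image of `t`, which puts the factor from `C_n` on the left of `t
    -- ^ ±1`; conjugation moves it back to the right.
    · refine ⟨(Multiplicative.ofAdd i)⁻¹, ?_⟩
      simp [hp, mul_assoc, sub_eq_add_neg]
    · refine ⟨(Multiplicative.ofAdd i)⁻¹, ?_⟩
      simp [hp, mul_assoc, sub_eq_add_neg]
  obtain ⟨c, hc⟩ := main
  -- Conjugation by `of c` does not disturb the values on `C_n`, which is abelian.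
  refine ⟨of c, HNNExtension.hom_ext (MonoidHom.ext fun x => ?_) ?_⟩
  · simp [← map_inv, ← map_mul, mul_comm c]
  · simpa using hc

/-- `endo p` composed with `endo p⁻¹`, in either order, is inner. -/
theorem endo_bijective (p : DihedralGroup n ⋊[dihedralAction n] MulAut (CyclicGrp n)) :
    Function.Bijective (endo p) := by
  have key : ∀ p q : DihedralGroup n ⋊[dihedralAction n] MulAut (CyclicGrp n), p * q = 1 →
      Function.Bijective (endo p ∘ endo q) := by
    intro p q h
    obtain ⟨u, hu⟩ := endo_comp_endo p q
    rw [h, endo_one, MonoidHom.comp_id] at hu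
    rw [← MonoidHom.coe_comp, hu]
    exact (MulAut.conj u).bijective
  exact ⟨(key p⁻¹ p (inv_mul_cancel p)).1.of_comp, (key p p⁻¹ (mul_inv_cancel p)).2.of_comp⟩

/-- The automorphism of `ℤ * C_n` attached to an element of `D_n ⋊ Aut(C_n)`. -/
noncomputable def aut (p : DihedralGroup n ⋊[dihedralAction n] MulAut (CyclicGrp n)) :
    MulAut (FreeExt (CyclicGrp n)) :=
  MulEquiv.ofBijective (endo p) (endo_bijective p)

theorem aut_apply (p : DihedralGroup n ⋊[dihedralAction n] MulAut (CyclicGrp n))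
    (x : FreeExt (CyclicGrp n)) : aut p x = endo p x := rfl

/-- The homomorphism from `D_n ⋊ Aut(C_n)` to the outer automorphisms of `ℤ * C_n`. -/
noncomputable def toOuter (n : ℕ) : DihedralGroup n ⋊[dihedralAction n] MulAut (CyclicGrp n) →*
    OuterAut (FreeExt (CyclicGrp n)) :=
  MonoidHom.mk' (fun p => (aut p : OuterAut (FreeExt (CyclicGrp n)))) fun p q => by
    obtain ⟨u, hu⟩ := endo_comp_endo p q
    have : aut p * aut q = MulAut.conj u * aut (p * q) :=
      MulEquiv.ext fun x => DFunLike.congr_fun hu x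
    rw [← QuotientGroup.mk_mul, this, QuotientGroup.mk_mul,
      (QuotientGroup.eq_one_iff _).2 (show MulAut.conj u ∈ InnerAut _ from ⟨u, rfl⟩), one_mul]

theorem toOuter_injective (n : ℕ) : Function.Injective (toOuter n) := by
  rw [injective_iff_map_eq_one]
  rintro ⟨d, θ⟩ hp
  obtain ⟨u, hu⟩ := (QuotientGroup.eq_one_iff _).1 hp
  have hx : ∀ x, u * x * u⁻¹ = endo ⟨d, θ⟩ x := fun x => DFunLike.congr_fun hu x
  have hθ : θ = 1 := MulEquiv.ext fun c => by
    have := congrArg retraction (hx (of c))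
    simpa [mul_comm (retraction u)] using this.symm
  -- The retraction of the image of `t` detects the rotation index, and its degree excludes flips.
  have hr := congrArg retraction (hx t)
  have hd := congrArg degree (hx t)
  rw [endo_t, map_mul, map_mul, map_inv, mul_comm, inv_mul_cancel_left] at hr hd
  subst hθ
  rcases d with i | i
  · have : i = 0 := by simpa using hr.symm
    subst this
    rfl
  · simp only [letterImage_sr, map_mul, map_inv, degree_t, degree_of] at hd
    have := congrArg Multiplicative.toAdd hd
    simp at this

theorem exists_conj_mul_eq [NeZero n] (φ : MulAut (FreeExt (CyclicGrp n))) :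
    ∃ (u : FreeExt (CyclicGrp n)) (θ : MulAut (CyclicGrp n)),
      ∀ c, (MulAut.conj u * φ) (of c) = of (θ c) := by
  obtain ⟨u, c₁, hu⟩ := exists_conj_of_isOfFinOrder
    (g := φ (of (Multiplicative.ofAdd 1))) <| by
      have := isOfFinOrder_of_finite (Multiplicative.ofAdd 1 : CyclicGrp n)
      exact (φ.toMonoidHom.comp of).isOfFinOrder this
  let ψ : CyclicGrp n →* FreeExt (CyclicGrp n) := (MulAut.conj u * φ).toMonoidHom.comp of
  have hψ : ∀ c, ψ c ∈ (of : CyclicGrp n →* FreeExt (CyclicGrp n)).range := by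
    intro c
    obtain ⟨k, rfl⟩ := CyclicGrp.exists_zpow_eq c
    refine ⟨c₁ ^ k, ?_⟩
    rw [map_zpow, map_zpow, ← hu]
    rfl
  let θ₀ : CyclicGrp n →* CyclicGrp n :=
    (MonoidHom.ofInjective (of_injective (MulEquiv.refl _))).symm.toMonoidHom.comp
      (ψ.codRestrict _ hψ)
  have hθ₀ : ∀ c, of (θ₀ c) = ψ c := fun c =>
    MonoidHom.apply_ofInjective_symm (of_injective (MulEquiv.refl _)) ⟨ψ c, hψ c⟩
  have hinj : Function.Injective θ₀ := by
    intro a b hab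
    have : ψ a = ψ b := by rw [← hθ₀, ← hθ₀, hab]
    exact of_injective _ ((MulAut.conj u * φ).injective this)
  exact ⟨u, MulEquiv.ofBijective θ₀ (Finite.injective_iff_bijective.1 hinj),
    fun c => (hθ₀ c).symm⟩

theorem toOuter_surjective [NeZero n] : Function.Surjective (toOuter n) := by
  intro o
  obtain ⟨φ, rfl⟩ := QuotientGroup.mk_surjective o
  obtain ⟨u, θ, hu⟩ := exists_conj_mul_eq φ
  have hmk : ∀ (v : FreeExt (CyclicGrp n)),
      ((MulAut.conj v : MulAut _) : OuterAut (FreeExt (CyclicGrp n))) = 1 :=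
    fun v => (QuotientGroup.eq_one_iff _).2 ⟨v, rfl⟩
  let χ := aut (n := n) ⟨1, θ⟩
  let φ₂ := MulAut.conj u * φ * χ⁻¹
  have hφ₂ : ∀ c, φ₂ (of c) = of c := by
    intro c
    have : χ (of (θ⁻¹ c)) = of c := by simp [χ, aut_apply]
    nth_rw 1 [← this]
    rw [MulAut.mul_apply, MulAut.inv_apply_self, hu]
    simp
  obtain ⟨a, b, e, h⟩ := exists_eq_of_forall_of φ₂ hφ₂
  -- Conjugating `a * t ^ e * b` by `a⁻¹` gives `t ^ e * (b * a)`; the sign `e` decides between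
  -- rotation and flip.
  obtain ⟨d, hd⟩ : ∃ d : DihedralGroup n, letterImage d = t ^ (e : ℤ) * of (b * a) := by
    rcases Int.units_eq_one_or e with rfl | rfl
    · exact ⟨.r (b * a).toAdd, by simp⟩
    · exact ⟨.sr (b * a).toAdd, by simp⟩
  have hφ₃ : MulAut.conj (of a⁻¹) * φ₂ = aut ⟨d, 1⟩ := by
    have : (MulAut.conj (of a⁻¹) * φ₂).toMonoidHom = endo ⟨d, 1⟩ := by
      refine HNNExtension.hom_ext (MonoidHom.ext fun x => ?_) ?_
      · simp [hφ₂, ← map_inv, ← map_mul, mul_comm a⁻¹]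
      · simp [h, hd, mul_assoc]
    exact MulEquiv.ext fun x => DFunLike.congr_fun this x
  refine ⟨⟨d, 1⟩ * ⟨1, θ⟩, ?_⟩
  rw [map_mul]
  change ((aut ⟨d, 1⟩ : MulAut _) : OuterAut (FreeExt (CyclicGrp n))) * (χ : MulAut _) = _
  rw [← hφ₃]
  simp only [φ₂, QuotientGroup.mk_mul, QuotientGroup.mk_inv, hmk, one_mul, inv_mul_cancel_right]

end FreeExt

/-! ### Transfer to the one-relator presentation, and the order of the group. -/

/-- Isomorphic groups have isomorphic outer automorphism groups. -/
def OuterAut.congr {G H : Type*} [Group G] [Group H] (e : G ≃* H) : OuterAut G ≃* OuterAut H :=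
  QuotientGroup.congr _ _ (MulAut.congr e) <| by
    ext φ
    constructor
    · rintro ⟨_, ⟨g, rfl⟩, rfl⟩
      exact ⟨e g, by ext x; simp [MulAut.congr]⟩
    · rintro ⟨h, rfl⟩
      exact ⟨_, ⟨e.symm h, rfl⟩, by ext x; simp [MulAut.congr]⟩

/-- The homomorphism from `C_n` given by an element whose order divides `n`. -/
def CyclicGrp.lift {K : Type*} [Group K] {n : ℕ} (k : K) (hk : k ^ n = 1) : CyclicGrp n →* K :=
  AddMonoidHom.toMultiplicativeLeft
    (ZMod.lift n ⟨zmultiplesHom _ (Additive.ofMul k), by simp [← ofMul_pow, hk]⟩)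

@[simp]
theorem CyclicGrp.lift_ofAdd_one {K : Type*} [Group K] {n : ℕ} (k : K) (hk : k ^ n = 1) :
    CyclicGrp.lift k hk (Multiplicative.ofAdd 1) = k := by
  change Additive.toMul (ZMod.lift n _ (1 : ZMod n)) = k
  rw [← Int.cast_one, ZMod.lift_coe]
  simp

theorem CyclicGrp.hom_ext {K : Type*} [Group K] {n : ℕ} {f g : CyclicGrp n →* K}
    (h : f (Multiplicative.ofAdd 1) = g (Multiplicative.ofAdd 1)) : f = g := by
  refine MonoidHom.ext fun c => ?_
  obtain ⟨k, rfl⟩ := CyclicGrp.exists_zpow_eq c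
  rw [map_zpow, map_zpow, h]

theorem CyclicGrp.ofAdd_one_pow (n : ℕ) : (Multiplicative.ofAdd 1 : CyclicGrp n) ^ n = 1 := by
  rw [← ofAdd_nsmul]; simp

theorem TwoGenOneRel.of_one_pow (n : ℕ) :
    (PresentedGroup.of 1 : TwoGenOneRel (FreeGroup.of 1) n) ^ n = 1 :=
  PresentedGroup.one_of_mem rfl

namespace FreeExt

open HNNExtension

/-- `⟨a, b; b ^ n⟩` is the free product of `C_n` and an infinite cyclic group. -/
def presentedEquiv (n : ℕ) : TwoGenOneRel (FreeGroup.of 1) n ≃* FreeExt (CyclicGrp n) :=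
  MonoidHom.toMulEquiv
    (PresentedGroup.toGroup (f := ![t, of (Multiplicative.ofAdd 1)]) <| by
      rintro _ rfl
      rw [map_pow, FreeGroup.lift_apply_of]
      simp [← map_pow, CyclicGrp.ofAdd_one_pow])
    (lift (CyclicGrp.lift (PresentedGroup.of 1) (TwoGenOneRel.of_one_pow n))
      (PresentedGroup.of 0))
    (by
      apply PresentedGroup.ext
      intro i
      fin_cases i <;> simp [PresentedGroup.toGroup.of])
    (by
      refine HNNExtension.hom_ext (CyclicGrp.hom_ext ?_) ?_ <;> simp [PresentedGroup.toGroup.of])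

/-- The comparison of the two models of `ℤ * C`. -/
def coprodEquiv (C : Type*) [Group C] : FreeExt C ≃* Monoid.Coprod (Multiplicative ℤ) C :=
  MonoidHom.toMulEquiv
    (lift Monoid.Coprod.inr (Monoid.Coprod.inl (Multiplicative.ofAdd 1)))
    (Monoid.Coprod.lift (zpowersHom _ t) of)
    (by refine HNNExtension.hom_ext (MonoidHom.ext fun c => ?_) ?_ <;> simp)
    (by
      refine Monoid.Coprod.hom_ext (MonoidHom.ext_mint ?_) (MonoidHom.ext fun c => ?_) <;> simp)

end FreeExt

theorem IsPrimitiveElement.exists_mulEquiv {R : FreeGroup (Fin 2)} (hR : IsPrimitiveElement R)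
    (j : Fin 2) : ∃ σ : FreeGroup (Fin 2) ≃* FreeGroup (Fin 2), σ R = FreeGroup.of j := by
  obtain ⟨ι, B, i, rfl⟩ := hR
  -- Free groups determine their rank, so the basis has two elements; the swap then sends the chosen
  -- one to the generator `j`.
  let e : ι ≃ Fin 2 := Equiv.ofFreeGroupEquiv B.repr.symm
  refine ⟨B.repr.trans (FreeGroup.freeGroupCongr (e.trans (Equiv.swap (e i) j))), ?_⟩
  simp

/-- A one-relator presentation with a primitive root of the relator is standard. -/
noncomputable def TwoGenOneRel.congr {R S : FreeGroup (Fin 2)}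
    (σ : FreeGroup (Fin 2) ≃* FreeGroup (Fin 2)) (hσ : σ R = S) (n : ℕ) :
    TwoGenOneRel R n ≃* TwoGenOneRel S n :=
  QuotientGroup.congr _ _ σ <| by
    rw [Subgroup.map_normalClosure _ _ σ.surjective]
    simp [hσ]

theorem card_mulAut_cyclicGrp (n : ℕ) [NeZero n] :
    Nat.card (MulAut (CyclicGrp n)) = Nat.totient n := by
  rw [IsCyclic.card_mulAut]
  simp

theorem mainTheorem5 (n : ℕ) (hn : 1 < n) (R : FreeGroup (Fin 2)) (hR : IsPrimitiveElement R) :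
    Nonempty (TwoGenOneRel R n ≃* TwoGenOneRel (FreeGroup.of 1) n) ∧
    Nonempty (TwoGenOneRel R n ≃* Monoid.Coprod (Multiplicative ℤ) (CyclicGrp n)) ∧
    Nonempty (OuterAut (TwoGenOneRel R n) ≃*
      DihedralGroup n ⋊[dihedralAction n] MulAut (CyclicGrp n)) ∧
    (∀ θ : MulAut (CyclicGrp n),
      dihedralAction n θ (DihedralGroup.sr 0) = DihedralGroup.sr 0) ∧
    (∀ (θ : MulAut (CyclicGrp n)) (i : ZMod n),
      dihedralAction n θ (DihedralGroup.r i) =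
        DihedralGroup.r (θ (Multiplicative.ofAdd i)).toAdd) ∧
    Nat.card (OuterAut (TwoGenOneRel R n)) = 2 * n * Nat.totient n := by
  have : NeZero n := ⟨by omega⟩
  obtain ⟨σ, hσ⟩ := hR.exists_mulEquiv 1
  let e₁ := TwoGenOneRel.congr σ hσ n
  let e₂ := e₁.trans (FreeExt.presentedEquiv n)
  let o : OuterAut (TwoGenOneRel R n) ≃*
      DihedralGroup n ⋊[dihedralAction n] MulAut (CyclicGrp n) :=
    (OuterAut.congr e₂).trans (MulEquiv.ofBijective (FreeExt.toOuter n)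
      ⟨FreeExt.toOuter_injective n, FreeExt.toOuter_surjective⟩).symm
  refine ⟨⟨e₁⟩, ⟨e₂.trans (FreeExt.coprodEquiv _)⟩, ⟨o⟩, fun θ => ?_, fun θ i => rfl, ?_⟩
  · simp [dihedralAction, dihedralAut]
  · rw [Nat.card_congr o.toEquiv, SemidirectProduct.card, DihedralGroup.nat_card,
      card_mulAut_cyclicGrp]
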